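/- **Setting.** Let $G$ be a finite connected undirected multigraph without loops, with vertices $v_0,\dots,v_n$ and adjacency matrix $A$ (so $A_{ij}$ is the number of edges joining $v_i$ and $v_j$). Let $R=(r_0,\dots,r_n)^T$ be a vector of positive integers with $\gcd(r_0,\dots,r_n)=1$, and suppose that there are natural numbers $\delta_0,\dots,\delta_n$ such that $(\mathcal D-A)R=\vec 0$, where $\mathcal D=\mathrm{diag}(\delta_0,\dots,\delta_n)$. Then $(G,R)$ is called an *arithmetical graph*. The *associated digraph* $\vec G_R$ has the same vertices as $G$, and is obtained by replacing each edge of $G$ joining $v_i$ and $v_j$ by $r_j$ edges directed from $v_i$ to $v_j$ and $r_i$ edges directed from $v_j$ to $v_i$. **Riemann–Roch property of a lattice.** Let $\Lambda\subseteq\mathbb Z^{n+1}$ be a lattice of rank $n$ that is orthogonal to a positive integer vector $R$. For a divisor $D\in\mathbb Z^{n+1}$ put $\deg_R(D)=R\cdot D$; divisors $D,D'$ are equivalent, $D\sim D'$, if $D-D'\in\Lambda$. Put $|D|=\{E\in\mathbb Z^{n+1}: E\ge \vec 0,\ E\sim D\}$ and $$r(D)=\min\{\deg_R(E): E\ge \vec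 0,\ |D-E|=\emptyset\}-1 .$$ Let $\Sigma(\Lambda)=\{D\in\mathbb Z^{n+1}: D\not\ge p\text{ for all }p\in\Lambda\}$, and let $\mathrm{Ext}(\Sigma(\Lambda))$ be the set of those $\nu\in\Sigma(\Lambda)$ with $\deg_R(\nu)\ge\deg_R(p)$ for all $p\in\Sigma(\Lambda)$ with $\sum_i|p_i-\nu_i|\le 1$. Let $g_{\min}-1$ and $g_{\max}-1$ be the minimum and the maximum of $\deg_R$ on $\mathrm{Ext}(\Sigma(\Lambda))$. The lattice $\Lambda$ has the *Riemann–Roch property* if $g_{\min}=g_{\max}=:g$ and there is a divisor $K\in\mathbb Z^{n+1}$ with $\deg_R(K)=2g-2$ such that $$r(D)-r(K-D)=\deg_R(D)-g+1\qquad\text{for all } D\in\mathbb Z^{n+1}.$$ **Column chip-firing game.** Let $\vec G$ be a strongly connected finite directed multigraph with vertices $v_0,\dots,v_n$. Its Laplacian is $\vec Q=\vec{\mathcal D}-\vec A$, where $\vec A_{ij}$ is the number of edges directed from $v_i$ to $v_j$ and $\vec{\mathcal D}$ is the diagonal matrix of the out-degrees. There is a unique vector $R$ of positive integers with greatest common divisor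 $1$ such that $R^T\vec Q=\vec 0^T$, called the currency vector of $\vec G$. One says that $\vec G$ *has the Riemann–Roch property for the column chip-firing game* if the lattice $\{\vec Qf:f\in\mathbb Z^{n+1}\}$ spanned by the columns of $\vec Q$ has rank $n$ and has the Riemann–Roch property with respect to the currency vector $R$. **Theorem.** Let $(G,R)$ be an arithmetical graph. Then the associated digraph $\vec G_R$ is strongly connected with currency vector $R$, and it has the Riemann–Roch property for the column chip-firing game. -/

import Mathlib

open scoped Graph

namespace ChipFiring

section Lattice

variable {V : Type*} [Fintype V]

/-- The degree `R · D` of a divisor `D` with respect to the weight vector `R`. -/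
def deg (R : V → ℕ) (D : V → ℤ) : ℤ := ∑ v, (R v : ℤ) * D v

/-- Two divisors are equivalent when their difference lies in the lattice. -/
def Equivalent (L : Submodule ℤ (V → ℤ)) (D D' : V → ℤ) : Prop := D - D' ∈ L

/-- The linear system `|D|`: all effective divisors equivalent to `D`. -/
def linearSystem (L : Submodule ℤ (V → ℤ)) (D : V → ℤ) : Set (V → ℤ) :=
  {E | 0 ≤ E ∧ Equivalent L E D}

/-- The degrees of those effective divisors `E` for which `|D - E|` is empty. -/
def emptyingDegrees (R : V → ℕ) (L : Submodule ℤ (V → ℤ)) (D : V → ℤ) : Set ℤ :=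
  {d | ∃ E : V → ℤ, 0 ≤ E ∧ linearSystem L (D - E) = ∅ ∧ deg R E = d}

/-- The rank `r(D) = min {deg_R E : |D - E| = ∅, E ≥ 0} - 1`. The minimum exists for every
lattice orthogonal to a positive weight vector: see `isLeast_rank`. -/
noncomputable def rank (R : V → ℕ) (L : Submodule ℤ (V → ℤ)) (D : V → ℤ) : ℤ :=
  sInf (emptyingDegrees R L D) - 1

theorem isLeast_rank [Nonempty V] {R : V → ℕ} (hR : ∀ v, 0 < R v)
    {L : Submodule ℤ (V → ℤ)} (hL : ∀ p ∈ L, deg R p = 0) (D : V → ℤ) :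
    IsLeast (emptyingDegrees R L D) (rank R L D + 1) := by
  have hbdd : BddBelow (emptyingDegrees R L D) := by
    refine ⟨0, ?_⟩
    rintro _ ⟨E, hE, -, rfl⟩
    exact Finset.sum_nonneg fun v _ => mul_nonneg (by positivity) (hE v)
  have hne : (emptyingDegrees R L D).Nonempty := by
    refine ⟨_, fun v => |D v| + 1, fun v => by simp only [Pi.zero_apply]; positivity, ?_, rfl⟩
    rw [Set.eq_empty_iff_forall_notMem]
    rintro F ⟨hF, hFD⟩
    have h0 := hL _ hFD
    have hpos : 0 < deg R (F - (D - fun v => |D v| + 1)) := by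
      refine Finset.sum_pos (fun v _ => mul_pos (by exact_mod_cast hR v) ?_)
        Finset.univ_nonempty
      have h1 : (0 : ℤ) ≤ F v := hF v
      have h2 := le_abs_self (D v)
      simp only [Pi.sub_apply]
      linarith
    omega
  have h := Int.csInf_mem hne hbdd
  rw [rank, sub_add_cancel]
  exact ⟨h, fun d hd => csInf_le hbdd hd⟩

/-- `Σ(L)`: the divisors that dominate no lattice point. -/
def sigmaRegion (L : Submodule ℤ (V → ℤ)) : Set (V → ℤ) := {D | ∀ p ∈ L, ¬ p ≤ D}

/-- `Ext(Σ(L))`: the points of `Σ(L)` whose degree is maximal among all points of `Σ(L)` at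
`ℓ¹`-distance at most one. -/
def extremeDivisors (R : V → ℕ) (L : Submodule ℤ (V → ℤ)) : Set (V → ℤ) :=
  {ν | ν ∈ sigmaRegion L ∧
    ∀ p ∈ sigmaRegion L, ∑ v, |p v - ν v| ≤ 1 → deg R p ≤ deg R ν}

/-- `g = g_min`, where `g_min = min {deg_R ν : ν ∈ Ext(Σ(L))} + 1`. -/
def IsGMin (R : V → ℕ) (L : Submodule ℤ (V → ℤ)) (g : ℤ) : Prop :=
  IsLeast (deg R '' extremeDivisors R L) (g - 1)

/-- `g = g_max`, where `g_max = max {deg_R ν : ν ∈ Ext(Σ(L))} + 1`. -/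
def IsGMax (R : V → ℕ) (L : Submodule ℤ (V → ℤ)) (g : ℤ) : Prop :=
  IsGreatest (deg R '' extremeDivisors R L) (g - 1)

/-- The Riemann-Roch property of a lattice `L`: it is a sublattice of
`Λ_R = {D : deg_R D = 0}` of rank `|V| - 1`, it is uniform (`g_min = g_max = g`), and there is
a divisor `K` of degree `2g - 2` for which the Riemann-Roch formula holds. -/
structure HasRiemannRoch (R : V → ℕ) (L : Submodule ℤ (V → ℤ)) : Prop where
  orthogonal : ∀ p ∈ L, deg R p = 0
  finrank_eq : Module.finrank ℤ L + 1 = Fintype.card V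
  formula : ∃ g : ℤ, IsGMin R L g ∧ IsGMax R L g ∧
    ∃ K : V → ℤ, deg R K = 2 * g - 2 ∧
      ∀ D : V → ℤ, rank R L D - rank R L (K - D) = deg R D - g + 1

end Lattice

section Digraph

variable {V : Type*} [Fintype V] [DecidableEq V]

/-- The out-degree of a vertex of a directed multigraph: the number of arrows leaving it. -/
noncomputable def outDegree (H : Quiver V) (i : V) : ℕ := Nat.card (Σ j, H.Hom i j)

/-- The Laplacian of a directed multigraph: out-degrees on the diagonal, minus the adjacency
matrix whose `(i, j)` entry is the number of arrows from `i` to `j`. -/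
noncomputable def laplacian (H : Quiver V) : Matrix V V ℤ :=
  Matrix.diagonal (fun i => (outDegree H i : ℤ)) -
    Matrix.of fun i j => (Nat.card (H.Hom i j) : ℤ)

/-- The lattice of the column chip-firing game: all integer combinations of the columns of the
Laplacian. Firing `i` once subtracts the `i`-th column: `i` loses as many chips as there are
arrows leaving it, and each arrow into `i` brings one chip to its source. -/
noncomputable def columnLattice (H : Quiver V) : Submodule ℤ (V → ℤ) :=
  Submodule.span ℤ (Set.range (laplacian H).col)

/-- The currency vector of a directed multigraph: the primitive positive integer vector `R` with
`Rᵀ Q = 0`, where `Q` is the Laplacian. A strongly connected digraph has exactly one. -/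
structure IsCurrencyVector (H : Quiver V) (R : V → ℕ) : Prop where
  pos : ∀ i, 0 < R i
  gcd_eq_one : Finset.univ.gcd R = 1
  left_kernel : Matrix.vecMul (fun i => (R i : ℤ)) (laplacian H) = 0

/-- A finite strongly connected directed multigraph with currency vector `R` has the
Riemann-Roch property for the column chip-firing game. -/
structure HasColumnRiemannRoch (H : Quiver V) (R : V → ℕ) : Prop where
  finite_arrows : ∀ i j, Finite (H.Hom i j)
  stronglyConnected : @Quiver.IsStronglyConnected V H
  currency : IsCurrencyVector H R
  riemannRoch : HasRiemannRoch R (columnLattice H)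

end Digraph

section Arithmetical

variable {V E : Type*} (G : Graph V E)

/-- The adjacency matrix of an undirected multigraph: its `(i, j)` entry is the number of edges
joining `i` and `j`. -/
noncomputable def adjacencyMatrix : Matrix V(G) V(G) ℤ :=
  Matrix.of fun i j => ({e | G.IsLink e i j}.ncard : ℤ)

/-- `(G, R)` is an arithmetical graph: `G` is a finite connected undirected multigraph without
loops, and `R` is a positive integer vector with coprime entries such that `(𝒟 - A) R = 0` for
some diagonal matrix `𝒟 = diag(δ)` of natural numbers. -/
structure IsArithmeticalGraph [Fintype V(G)] [DecidableEq V(G)] (R : V(G) → ℕ) : Prop where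
  finite_edges : E(G).Finite
  loopless : G.Loopless
  connected : G.toSimpleGraph.Connected
  pos : ∀ i, 0 < R i
  gcd_eq_one : Finset.univ.gcd R = 1
  exists_laplacian : ∃ δ : V(G) → ℕ,
    Matrix.mulVec (Matrix.diagonal (fun i => (δ i : ℤ)) - adjacencyMatrix G)
      (fun i => (R i : ℤ)) = 0

/-- The digraph associated with `(G, R)`: each edge joining `i` and `j` is replaced by `R j`
arrows from `i` to `j` and `R i` arrows from `j` to `i`. So an arrow from `i` to `j` is an edge
joining them together with an index in `{0, …, R j - 1}`. -/
@[reducible] def associatedDigraph (R : V(G) → ℕ) : Quiver V(G) where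
  Hom i j := {e : E // G.IsLink e i j} × Fin (R j)

end Arithmetical

end ChipFiring

/-! If `m i j` edges join `i` and `j`, the digraph has `w i j = m i j * R j` arrows from `i` to `j`,
so `R i * w i j` is symmetric. This symmetry lets the Riemann–Roch argument for undirected graphs
run with the degree weighted by `R`.

An injective `σ` orients the edges acyclically and gives a divisor `ν_σ`. Reversing the order gives
`ν_σ + ν_{-σ} = K`, and by symmetry both have the same degree, so every `ν_σ` has degree `deg K / 2
= g - 1`. The lattice translates of the `ν_σ` lie in `Σ` (`not_lap_le_orderDivisor`), and reduction
followed by burning shows that they dominate all of `Σ` (`exists_le_orderDivisor`). Hence extreme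
divisors all have degree `g - 1`. The reflection `ν ↦ K - ν` permutes these translates, and
comparing positive parts of `D - ν` and `ν - D` yields the formula. -/

namespace ChipFiring

/-! ### Symmetrizable Laplacians: potentials and the rank of the lattice -/

section Weighted

variable {V : Type*} [Fintype V]

/-- The Laplacian operator of a weight matrix `w`: `(Q f) i = ∑ j, w i j * (f i - f j)`. -/
def lap (w : V → V → ℤ) : (V → ℤ) →ₗ[ℤ] (V → ℤ) where
  toFun f i := ∑ j, w i j * (f i - f j)
  map_add' f g := by
    ext i
    simp only [Pi.add_apply, ← Finset.sum_add_distrib]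
    exact Finset.sum_congr rfl fun j _ => by ring
  map_smul' c f := by
    ext i
    simp only [Pi.smul_apply, smul_eq_mul, Finset.mul_sum, RingHom.id_apply]
    exact Finset.sum_congr rfl fun j _ => by ring

theorem lap_apply (w : V → V → ℤ) (f : V → ℤ) (i : V) :
    lap w f i = ∑ j, w i j * (f i - f j) := rfl

/-- Nonnegative loopless weights on a connected graph that become symmetric once the `i`-th row
is multiplied by `R i`. -/
structure IsSymmetrizable (R : V → ℕ) (w : V → V → ℤ) : Prop where
  pos : ∀ i, 0 < R i
  nonneg : ∀ i j, 0 ≤ w i j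
  diag : ∀ i, w i i = 0
  symm : ∀ i j, (R i : ℤ) * w i j = R j * w j i
  connected : (SimpleGraph.fromRel fun i j => 0 < w i j).Connected

theorem deg_add (R : V → ℕ) (D D' : V → ℤ) : deg R (D + D') = deg R D + deg R D' := by
  simp only [deg, Pi.add_apply, mul_add, Finset.sum_add_distrib]

theorem deg_neg (R : V → ℕ) (D : V → ℤ) : deg R (-D) = -deg R D := by
  simp only [deg, Pi.neg_apply, mul_neg, Finset.sum_neg_distrib]

theorem deg_sub (R : V → ℕ) (D D' : V → ℤ) : deg R (D - D') = deg R D - deg R D' := by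
  rw [sub_eq_add_neg, deg_add, deg_neg, sub_eq_add_neg]

theorem deg_mono (R : V → ℕ) {D D' : V → ℤ} (h : D ≤ D') : deg R D ≤ deg R D' :=
  Finset.sum_le_sum fun i _ => mul_le_mul_of_nonneg_left (h i) (by positivity)

namespace IsSymmetrizable

variable {R : V → ℕ} {w : V → V → ℤ} (h : IsSymmetrizable R w)
include h

omit [Fintype V] in
theorem pos_symm {i j : V} (hij : 0 < w i j) : 0 < w j i := by
  have h1 : (0 : ℤ) < R i := by exact_mod_cast h.pos i
  have h2 : (0 : ℤ) < R j := by exact_mod_cast h.pos j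
  have h3 : 0 < (R j : ℤ) * w j i := by rw [← h.symm i j]; positivity
  exact pos_of_mul_pos_right h3 h2.le

omit [Fintype V] in
theorem pos_of_adj {i j : V} (hij : (SimpleGraph.fromRel fun i j => 0 < w i j).Adj i j) :
    0 < w i j := by
  rw [SimpleGraph.fromRel_adj] at hij
  exact hij.2.elim id h.pos_symm

theorem deg_lap (f : V → ℤ) : deg R (lap w f) = 0 := by
  have h1 : deg R (lap w f) = ∑ i, ∑ j, (R i : ℤ) * w i j * (f i - f j) := by
    simp only [deg, lap_apply, Finset.mul_sum, mul_assoc]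
  -- Exchanging `i` and `j` negates the sum, since `R i * w i j` is symmetric.
  have h2 : ∑ i, ∑ j, (R i : ℤ) * w i j * (f i - f j) =
      ∑ i, ∑ j, -((R i : ℤ) * w i j * (f i - f j)) := by
    rw [Finset.sum_comm]
    refine Finset.sum_congr rfl fun i _ => Finset.sum_congr rfl fun j _ => ?_
    rw [h.symm j i]
    ring
  simp only [Finset.sum_neg_distrib] at h2
  omega

/-- A potential whose firing strictly increases the number of chips at every vertex but `q`. -/
theorem exists_potential (q : V) : ∃ u : V → ℤ, ∀ i, i ≠ q → lap w u i ≤ -1 := by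
  classical
  set Γ := SimpleGraph.fromRel fun i j => 0 < w i j with hΓ
  set N := ∑ i, Γ.dist i q with hN
  set B : ℤ := (∑ i, ∑ j, w i j) + 1 with hB
  have hB1 : 1 ≤ B := by
    have : 0 ≤ ∑ i, ∑ j, w i j :=
      Finset.sum_nonneg fun i _ => Finset.sum_nonneg fun j _ => h.nonneg i j
    omega
  have hdN (i : V) : Γ.dist i q ≤ N :=
    Finset.single_le_sum (f := fun i => Γ.dist i q) (fun _ _ => Nat.zero_le _) (Finset.mem_univ i)
  -- The base `B` exceeds every row sum, so a single neighbour nearer to `q` outweighs the whole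
  -- term `(∑ j, w i j) * u i`. The offset `N` keeps the exponents from truncating.
  refine ⟨fun i => B ^ (N - Γ.dist i q), fun i hi => ?_⟩
  obtain ⟨k, hk, hkd⟩ : ∃ k, Γ.Adj i k ∧ Γ.dist k q < Γ.dist i q := by
    obtain ⟨p, hp⟩ := h.connected.exists_walk_length_eq_dist i q
    cases p with
    | nil => exact absurd rfl hi
    | cons hadj p =>
      refine ⟨_, hadj, ?_⟩
      have := SimpleGraph.dist_le p
      rw [SimpleGraph.Walk.length_cons] at hp
      exact (Nat.lt_succ_of_le this).trans_eq hp
  have hwk : 1 ≤ w i k := h.pos_of_adj hk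
  set x : ℤ := B ^ (N - Γ.dist i q) with hx
  have hx1 : 1 ≤ x := one_le_pow₀ hB1
  have hkx : B * x ≤ B ^ (N - Γ.dist k q) := by
    rw [hx, ← pow_succ']
    have := hdN i
    exact pow_le_pow_right₀ hB1 (by omega)
  have hrow : ∑ j, w i j ≤ B - 1 := by
    have := Finset.single_le_sum (f := fun i => ∑ j, w i j)
      (fun i _ => Finset.sum_nonneg fun j _ => h.nonneg i j) (Finset.mem_univ i)
    omega
  have hnbr : w i k * B ^ (N - Γ.dist k q) ≤ ∑ j, w i j * B ^ (N - Γ.dist j q) :=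
    Finset.single_le_sum (f := fun j => w i j * B ^ (N - Γ.dist j q))
      (fun j _ => mul_nonneg (h.nonneg i j) (by positivity)) (Finset.mem_univ k)
  have hbig : B * x ≤ w i k * B ^ (N - Γ.dist k q) := by
    refine hkx.trans (le_mul_of_one_le_left (by positivity) hwk)
  have hrx : (∑ j, w i j) * x ≤ (B - 1) * x := mul_le_mul_of_nonneg_right hrow (by omega)
  have hexp : lap w (fun i => B ^ (N - Γ.dist i q)) i =
      (∑ j, w i j) * x - ∑ j, w i j * B ^ (N - Γ.dist j q) := by
    simp only [lap_apply, mul_sub, Finset.sum_sub_distrib, Finset.sum_mul, hx]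
  rw [hexp]
  linarith

/-- The maximum principle. -/
theorem le_of_lap_neg {q : V} {u : V → ℤ} (hu : ∀ i, i ≠ q → lap w u i ≤ -1) (i : V) :
    u i ≤ u q := by
  obtain ⟨m, -, hm⟩ := Finset.exists_max_image Finset.univ u ⟨q, Finset.mem_univ q⟩
  by_cases hmq : m = q
  · exact hmq ▸ hm i (Finset.mem_univ i)
  · have h1 := hu m hmq
    have h2 : 0 ≤ lap w u m := Finset.sum_nonneg fun j _ =>
      mul_nonneg (h.nonneg m j) (sub_nonneg.2 (hm j (Finset.mem_univ j)))
    omega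

/-- The maximum principle applies to `c • f + u` for every integer `c`, so all multiples of `f i - f
q` share one upper bound. -/
theorem eq_of_lap_eq_zero {f : V → ℤ} (hf : lap w f = 0) (i q : V) : f i = f q := by
  obtain ⟨u, hu⟩ := h.exists_potential q
  have key (c : ℤ) : c * f i + u i ≤ c * f q + u q := by
    refine h.le_of_lap_neg (u := c • f + u) (fun j hj => ?_) i
    rw [map_add, map_smul, hf, smul_zero, zero_add]
    exact hu j hj
  by_contra hne
  have hsq : 0 < (f i - f q) * (f i - f q) := mul_self_pos.2 (sub_ne_zero.2 hne)
  have h1 := key ((f i - f q) * (|u q - u i| + 1))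
  have h2 := le_abs_self (u q - u i)
  have h3 : |u q - u i| + 1 ≤ (f i - f q) * (f i - f q) * (|u q - u i| + 1) :=
    le_mul_of_one_le_left (by positivity) hsq
  nlinarith

theorem finrank_range_lap : Module.finrank ℤ (LinearMap.range (lap w)) + 1 = Fintype.card V := by
  obtain ⟨q⟩ := h.connected.nonempty
  have hone : lap w 1 = 0 := by
    ext i
    simp [lap_apply]
  have hker : LinearMap.ker (lap w) = Submodule.span ℤ {(1 : V → ℤ)} := by
    ext f
    rw [LinearMap.mem_ker, Submodule.mem_span_singleton]
    constructor
    · intro hf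
      refine ⟨f q, ?_⟩
      ext i
      simp [h.eq_of_lap_eq_zero hf i q]
    · rintro ⟨c, rfl⟩
      rw [map_smul, hone, smul_zero]
  have h1 : (1 : V → ℤ) ≠ 0 := fun h0 => one_ne_zero (congrFun h0 q)
  have h2 := Submodule.finrank_quotient_add_finrank (LinearMap.ker (lap w))
  rwa [(lap w).quotKerEquivRange.finrank_eq, hker,
    ← (LinearEquiv.toSpanNonzeroSingleton ℤ _ _ h1).finrank_eq, Module.finrank_self,
    Module.finrank_fintype_fun_eq_card] at h2

end IsSymmetrizable

/-! ### Divisors of vertex orders and the canonical divisor -/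

section Orders

variable (w : V → V → ℤ)

/-- The divisor of the acyclic orientation in which the edges point to the larger value of `σ`. -/
def orderDivisor (σ : V → ℤ) : V → ℤ := fun i => ∑ j with σ j < σ i, w i j - 1

/-- The canonical divisor of a weighted graph. -/
def canonicalDivisor : V → ℤ := fun i => ∑ j, w i j - 2

end Orders

namespace IsSymmetrizable

variable {R : V → ℕ} {w : V → V → ℤ} (h : IsSymmetrizable R w)
include h

theorem canonicalDivisor_sub_orderDivisor {σ : V → ℤ} (hσ : σ.Injective) :
    canonicalDivisor w - orderDivisor w σ = orderDivisor w (-σ) := by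
  classical
  ext i
  simp only [canonicalDivisor, orderDivisor, Pi.sub_apply, Pi.neg_apply, neg_lt_neg_iff]
  have h1 : ∑ j, w i j = ∑ j with σ j < σ i, w i j + ∑ j with σ i < σ j, w i j := by
    simp only [Finset.sum_filter, ← Finset.sum_add_distrib]
    refine Finset.sum_congr rfl fun j _ => ?_
    rcases lt_trichotomy (σ j) (σ i) with hlt | heq | hgt
    · simp [hlt, hlt.not_gt]
    · simp [hσ heq, h.diag]
    · simp [hgt, hgt.not_gt]
  omega

theorem deg_orderDivisor_neg (σ : V → ℤ) :
    deg R (orderDivisor w (-σ)) = deg R (orderDivisor w σ) := by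
  have h1 (τ : V → ℤ) : deg R (orderDivisor w τ) =
      ∑ i, ∑ j, (if τ j < τ i then (R i : ℤ) * w i j else 0) - ∑ i, (R i : ℤ) := by
    simp only [deg, orderDivisor, mul_sub, mul_one, Finset.sum_sub_distrib, Finset.sum_filter,
      Finset.mul_sum, mul_ite, mul_zero]
  rw [h1, h1, Finset.sum_comm]
  simp only [Pi.neg_apply, neg_lt_neg_iff]
  congr 1
  refine Finset.sum_congr rfl fun i _ => Finset.sum_congr rfl fun j _ => ?_
  rw [h.symm j i]

theorem two_mul_deg_orderDivisor {σ : V → ℤ} (hσ : σ.Injective) :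
    2 * deg R (orderDivisor w σ) = deg R (canonicalDivisor w) := by
  have h1 := congrArg (deg R) (h.canonicalDivisor_sub_orderDivisor hσ)
  rw [deg_sub, h.deg_orderDivisor_neg] at h1
  omega

/-- The divisor of an acyclic orientation is not equivalent to an effective divisor. -/
theorem not_lap_le_orderDivisor (σ f : V → ℤ) : ¬ lap w f ≤ orderDivisor w σ := by
  classical
  obtain ⟨q⟩ := h.connected.nonempty
  obtain ⟨m, -, hm⟩ := Finset.exists_max_image Finset.univ f ⟨q, Finset.mem_univ q⟩
  -- At the `σ`-least maximizer of `f`, every `σ`-smaller vertex has strictly smaller `f`, so each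
  -- arrow to it costs at least one chip.
  obtain ⟨i, hi, hmin⟩ := Finset.exists_min_image (Finset.univ.filter fun i => f i = f m) σ
    ⟨m, by simp⟩
  rw [Finset.mem_filter] at hi
  intro hle
  have h1 : lap w f i ≤ ∑ j with σ j < σ i, w i j - 1 := hle i
  have h2 : ∑ j with σ j < σ i, w i j ≤ lap w f i := by
    rw [Finset.sum_filter, lap_apply]
    refine Finset.sum_le_sum fun j _ => ?_
    have hj := hm j (Finset.mem_univ j)
    split_ifs with hlt
    · refine le_mul_of_one_le_right (h.nonneg i j) ?_
      have : f j ≠ f m := fun heq => hlt.not_ge (hmin j (by simp [heq]))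
      omega
    · exact mul_nonneg (h.nonneg i j) (by omega)
  omega

/-! ### Burning and reduced divisors -/

omit h in
/-- Dhar's burning algorithm: if no set of vertices can fire, then some order burns everything. -/
theorem exists_order_of_burning [DecidableEq V] (hw : ∀ i j, 0 ≤ w i j) {D : V → ℤ}
    (hD : ∀ S : Finset V, S.Nonempty → ∃ i ∈ S, D i < ∑ j with j ∉ S, w i j) (S : Finset V) :
    ∃ σ : V → ℕ, Set.InjOn σ S ∧
      ∀ i ∈ S, D i < ∑ j with j ∉ S ∨ σ j < σ i, w i j := by
  induction S using Finset.strongInduction with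
  | H S ih =>
    rcases S.eq_empty_or_nonempty with rfl | hS
    · exact ⟨0, by simp, by simp⟩
    obtain ⟨i, hi, hDi⟩ := hD S hS
    obtain ⟨σ, hinj, hσ⟩ := ih (S.erase i) (Finset.erase_ssubset hi)
    -- Vertices outside `S` have already burnt; `i` burns next, hence the value 0, and the rest of
    -- `S` is shifted to burn after it.
    refine ⟨fun x => if x = i then 0 else σ x + 1, ?_, ?_⟩
    · intro x hx y hy hxy
      simp only at hxy
      split_ifs at hxy with h1 h2 h2
      · rw [h1, h2]
      · exact hinj (by simp_all) (by simp_all) (by omega)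
    · intro x hx
      by_cases hxi : x = i
      · subst hxi
        refine hDi.trans_le (Finset.sum_le_sum_of_subset_of_nonneg ?_ fun j _ _ => hw x j)
        intro j
        simp +contextual
      · refine (hσ x (by simp [hxi, hx])).trans_le
          (Finset.sum_le_sum_of_subset_of_nonneg ?_ fun j _ _ => hw x j)
        intro j
        simp only [Finset.mem_filter, Finset.mem_univ, true_and, Finset.mem_erase, hxi, if_false]
        by_cases hj : j = i
        · simp [hj]
        · simp [hj]

/-- Adding a large multiple of a potential clears all debts away from `q`. -/
theorem exists_effective_away (q : V) (D : V → ℤ) :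
    ∃ f : V → ℤ, ∀ i, i ≠ q → 0 ≤ (D - lap w f) i := by
  obtain ⟨u, hu⟩ := h.exists_potential q
  refine ⟨(∑ i, |D i|) • u, fun i hi => ?_⟩
  have h1 : |D i| ≤ ∑ i, |D i| :=
    Finset.single_le_sum (f := fun i => |D i|) (fun j _ => abs_nonneg _) (Finset.mem_univ i)
  have h2 := neg_abs_le (D i)
  have h3 : (0 : ℤ) ≤ |D i| := abs_nonneg _
  have h4 := mul_le_mul_of_nonneg_left (hu i hi) (h3.trans h1)
  rw [map_smul, Pi.sub_apply, Pi.smul_apply, smul_eq_mul]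
  linarith

/-- Firing scripts that vanish at `q` and leave no debt away from `q` are bounded above. -/
theorem exists_bound (q : V) (D : V → ℤ) : ∃ M : ℤ, ∀ f : V → ℤ, f q = 0 →
    (∀ i, i ≠ q → 0 ≤ (D - lap w f) i) → ∑ i, f i ≤ M := by
  obtain ⟨u, hu⟩ := h.exists_potential q
  -- Away from `q`, `lap w f ≤ D`, so adding `c • u` brings the Laplacian down to at most `-1` and
  -- the maximum principle applies.
  set c := ∑ i, |D i| + 1 with hc
  refine ⟨∑ i, c * (u q - u i), fun f hfq hf => Finset.sum_le_sum fun i _ => ?_⟩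
  have h0 := h.le_of_lap_neg (q := q) (u := f + c • u) (fun j hj => ?_) i
  · simp only [Pi.add_apply, Pi.smul_apply, smul_eq_mul, hfq] at h0
    linarith
  · have h1 : |D j| ≤ ∑ i, |D i| :=
      Finset.single_le_sum (f := fun i => |D i|) (fun j _ => abs_nonneg _) (Finset.mem_univ j)
    have h2 := le_abs_self (D j)
    have h3 : (0 : ℤ) ≤ |D j| := abs_nonneg _
    have h4 := mul_le_mul_of_nonneg_left (hu j hj) (by omega : 0 ≤ c)
    have h5 := hf j hj
    rw [Pi.sub_apply] at h5
    rw [map_add, map_smul, Pi.add_apply, Pi.smul_apply, smul_eq_mul]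
    linarith

omit h in
theorem lap_indicator_of_mem [DecidableEq V] {S : Finset V} {i : V} (hi : i ∈ S) :
    lap w (fun j => if j ∈ S then 1 else 0) i = ∑ j with j ∉ S, w i j := by
  rw [lap_apply, Finset.sum_filter]
  refine Finset.sum_congr rfl fun j _ => ?_
  by_cases hj : j ∈ S <;> simp [hi, hj]

theorem lap_indicator_of_notMem [DecidableEq V] {S : Finset V} {i : V} (hi : i ∉ S) :
    lap w (fun j => if j ∈ S then 1 else 0) i ≤ 0 := by
  rw [lap_apply]
  refine Finset.sum_nonpos fun j _ => mul_nonpos_of_nonneg_of_nonpos (h.nonneg i j) ?_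
  split_ifs <;> simp

/-- Every divisor is equivalent to a `q`-reduced one. -/
theorem exists_reduced [DecidableEq V] (q : V) (D : V → ℤ) :
    ∃ f : V → ℤ, (∀ i, i ≠ q → 0 ≤ (D - lap w f) i) ∧
      ∀ S : Finset V, S.Nonempty → q ∉ S → ∃ i ∈ S, (D - lap w f) i < ∑ j with j ∉ S, w i j := by
  let P : ℤ → Prop := fun s => ∃ f : V → ℤ, f q = 0 ∧
    (∀ i, i ≠ q → 0 ≤ (D - lap w f) i) ∧ ∑ i, f i = s
  obtain ⟨M, hM⟩ := h.exists_bound q D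
  have hne : ∃ s, P s := by
    obtain ⟨f, hf⟩ := h.exists_effective_away q D
    have hshift : lap w (fun i => f i - f q) = lap w f := by
      ext i
      simp [lap_apply]
    exact ⟨_, fun i => f i - f q, sub_self _, fun i hi => by rw [hshift]; exact hf i hi, rfl⟩
  -- A script of maximal total is reduced: a set avoiding `q` that could still fire would increase
  -- the total by its cardinality.
  obtain ⟨s, ⟨f, hfq, hf, rfl⟩, hmax⟩ := Int.exists_greatest_of_bdd (P := P)
    ⟨M, fun s ⟨f, hfq, hf, hs⟩ => hs ▸ hM f hfq hf⟩ hne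
  refine ⟨f, hf, fun S hS hqS => ?_⟩
  by_contra! hcon
  let e : V → ℤ := fun j => if j ∈ S then 1 else 0
  have hle := hmax (∑ i, (f + e) i) ⟨f + e, by simp [e, hfq, hqS], fun i hi => ?_, rfl⟩
  · have hcard : ∑ i, e i = S.card := by simp [e]
    have := hS.card_pos
    simp only [Pi.add_apply, Finset.sum_add_distrib, hcard] at hle
    omega
  · rw [map_add, ← sub_sub, Pi.sub_apply]
    by_cases hiS : i ∈ S
    · rw [lap_indicator_of_mem hiS]
      exact sub_nonneg.2 (hcon i hiS)
    · have h1 := h.lap_indicator_of_notMem hiS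
      have h2 := hf i hi
      exact sub_nonneg.2 (h1.trans h2)

/-- Every divisor that dominates no lattice point is dominated by a translate of the divisor of
an acyclic orientation. -/
theorem exists_le_orderDivisor {D : V → ℤ}
    (hD : D ∈ sigmaRegion (LinearMap.range (lap w))) :
    ∃ σ : V → ℤ, σ.Injective ∧ ∃ p ∈ LinearMap.range (lap w), D ≤ orderDivisor w σ + p := by
  classical
  obtain ⟨q⟩ := h.connected.nonempty
  obtain ⟨f, hf, hred⟩ := h.exists_reduced q D
  have hq : (D - lap w f) q < 0 := by
    by_contra! hq
    refine hD _ ⟨f, rfl⟩ (sub_nonneg.1 fun i => ?_)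
    by_cases hi : i = q
    · exact hi ▸ hq
    · exact hf i hi
  -- The debt at `q` starts the fire: it settles the sets containing `q`, and reducedness settles
  -- the others.
  obtain ⟨σ, hinj, hσ⟩ := exists_order_of_burning h.nonneg (D := D - lap w f) (fun S hS => by
    by_cases hqS : q ∈ S
    · exact ⟨q, hqS, hq.trans_le (Finset.sum_nonneg fun j _ => h.nonneg q j)⟩
    · exact hred S hS hqS) Finset.univ
  refine ⟨fun i => σ i, fun i j hij => hinj (by simp) (by simp) (Nat.cast_injective hij),
    lap w f, ⟨f, rfl⟩, fun i => ?_⟩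
  have h1 := hσ i (Finset.mem_univ i)
  simp only [Finset.mem_univ, not_true_eq_false, false_or, Pi.sub_apply] at h1
  simp only [Pi.add_apply, orderDivisor, Nat.cast_lt]
  omega

theorem orderDivisor_add_mem_sigmaRegion (σ : V → ℤ) {p : V → ℤ}
    (hp : p ∈ LinearMap.range (lap w)) :
    orderDivisor w σ + p ∈ sigmaRegion (LinearMap.range (lap w)) := by
  intro p' hp' hle
  obtain ⟨f, hf⟩ := Submodule.sub_mem _ hp' hp
  refine h.not_lap_le_orderDivisor σ f ?_
  rw [hf]
  exact sub_le_iff_le_add.2 hle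

theorem deg_orderDivisor_add (σ : V → ℤ) {p : V → ℤ} (hp : p ∈ LinearMap.range (lap w)) :
    deg R (orderDivisor w σ + p) = deg R (orderDivisor w σ) := by
  obtain ⟨f, rfl⟩ := hp
  rw [deg_add, h.deg_lap, add_zero]

omit [Fintype V] h in
theorem mem_sigmaRegion_of_le {L : Submodule ℤ (V → ℤ)} {D D' : V → ℤ} (hle : D ≤ D')
    (hD' : D' ∈ sigmaRegion L) : D ∈ sigmaRegion L :=
  fun p hp hpD => hD' p hp (hpD.trans hle)

/-! ### Degrees of extreme divisors -/

/-- All extreme divisors have the degree of half the canonical divisor. -/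
theorem two_mul_deg_extreme {ν : V → ℤ}
    (hν : ν ∈ extremeDivisors R (LinearMap.range (lap w))) :
    2 * deg R ν = deg R (canonicalDivisor w) := by
  classical
  obtain ⟨σ, hσ, p, hp, hle⟩ := h.exists_le_orderDivisor hν.1
  suffices hsuff : ν = orderDivisor w σ + p by
    rw [hsuff, h.deg_orderDivisor_add σ hp, h.two_mul_deg_orderDivisor hσ]
  by_contra hne
  obtain ⟨i, hi⟩ : ∃ i, ν i < (orderDivisor w σ + p) i := by
    by_contra! hcon
    exact hne (le_antisymm hle hcon)
  -- One more chip at `i` stays below the translate, hence in `Σ`, but raises the degree by `R i >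
  -- 0`, against local maximality.
  have hmem : ν + Pi.single i 1 ∈ sigmaRegion (LinearMap.range (lap w)) := by
    refine mem_sigmaRegion_of_le (fun j => ?_) (h.orderDivisor_add_mem_sigmaRegion σ hp)
    by_cases hj : j = i
    · subst hj
      rw [Pi.add_apply, Pi.single_eq_same]
      exact hi
    · rw [Pi.add_apply, Pi.single_eq_of_ne hj, add_zero]
      exact hle j
  have h1 := hν.2 _ hmem (by simp [Pi.single_apply, apply_ite abs])
  have h2 : deg R (Pi.single i 1) = R i := by simp [deg, Pi.single_apply]
  have h3 := h.pos i
  rw [deg_add, h2] at h1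
  omega

theorem two_mul_deg_le {D : V → ℤ} (hD : D ∈ sigmaRegion (LinearMap.range (lap w))) :
    2 * deg R D ≤ deg R (canonicalDivisor w) := by
  obtain ⟨σ, hσ, p, hp, hle⟩ := h.exists_le_orderDivisor hD
  have h1 := deg_mono R hle
  rw [h.deg_orderDivisor_add σ hp] at h1
  have := h.two_mul_deg_orderDivisor hσ
  omega

/-! ### Rank and the Riemann–Roch formula -/

omit [Fintype V] h in
theorem linearSystem_eq_empty_iff {L : Submodule ℤ (V → ℤ)} {D : V → ℤ} :
    linearSystem L D = ∅ ↔ D ∈ sigmaRegion L := by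
  rw [Set.eq_empty_iff_forall_notMem]
  constructor
  · intro hD p hp hle
    refine hD (D - p) ⟨sub_nonneg.2 hle, ?_⟩
    rw [Equivalent, sub_sub_cancel_left]
    exact L.neg_mem hp
  · rintro hD F ⟨hF, hFD⟩
    refine hD (D - F) ?_ (sub_le_self D hF)
    rw [← neg_sub]
    exact L.neg_mem hFD

-- This is `x⁺ = x + (-x)⁺` for `x = D - ν`, with `-x` written through the reflection in `K`.
omit h in
theorem deg_posPart_sub (D ν K : V → ℤ) :
    deg R ((D - ν) ⊔ 0) = deg R D - deg R ν + deg R (((K - D) - (K - ν)) ⊔ 0) := by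
  rw [← deg_sub, ← deg_add]
  congr 1
  ext i
  simp only [Pi.sup_apply, Pi.sub_apply, Pi.add_apply, Pi.zero_apply]
  omega

/-- The inequality underlying both halves of the Riemann-Roch formula. -/
theorem rank_canonical_sub_le (D : V → ℤ) :
    2 * rank R (LinearMap.range (lap w)) (canonicalDivisor w - D) ≤
      2 * rank R (LinearMap.range (lap w)) D - 2 * deg R D + deg R (canonicalDivisor w) := by
  have := h.connected.nonempty
  have hL : ∀ p ∈ LinearMap.range (lap w), deg R p = 0 := by
    rintro _ ⟨f, rfl⟩
    exact h.deg_lap f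
  obtain ⟨E, hE, hempty, hdeg⟩ := (isLeast_rank h.pos hL D).1
  rw [linearSystem_eq_empty_iff] at hempty
  obtain ⟨σ, hσ, p, hp, hle⟩ := h.exists_le_orderDivisor hempty
  set ν := orderDivisor w σ + p with hν
  set K := canonicalDivisor w with hK
  -- `E` is optimal for `D` and `D - E ≤ ν`, so `E` dominates `(D - ν)⁺`. The reflected positive
  -- part is then a candidate for the rank of `K - D`.
  have h1 : deg R ((D - ν) ⊔ 0) ≤ deg R E :=
    deg_mono R (sup_le (by rwa [sub_le_comm]) hE)
  have h2 : K - ν ∈ sigmaRegion (LinearMap.range (lap w)) := by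
    rw [hν, ← sub_sub, hK, h.canonicalDivisor_sub_orderDivisor hσ, sub_eq_add_neg]
    exact h.orderDivisor_add_mem_sigmaRegion _ (Submodule.neg_mem _ hp)
  have h3 := (isLeast_rank h.pos hL (K - D)).2 ⟨((K - D) - (K - ν)) ⊔ 0, le_sup_right,
    linearSystem_eq_empty_iff.2 (mem_sigmaRegion_of_le
      (by rw [sub_le_comm]; exact le_sup_left) h2), rfl⟩
  have h4 := deg_posPart_sub (R := R) D ν K
  have h5 := h.two_mul_deg_orderDivisor hσ
  have h6 := h.deg_orderDivisor_add σ hp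
  rw [← hν] at h6
  rw [← hK] at h5
  omega

/-- Since `D ↦ K - D` is an involution, the inequality used at `D` and at `K - D` bounds the
difference from both sides. -/
theorem rank_sub_rank_canonical_sub (D : V → ℤ) :
    2 * (rank R (LinearMap.range (lap w)) D -
      rank R (LinearMap.range (lap w)) (canonicalDivisor w - D)) =
      2 * deg R D - deg R (canonicalDivisor w) := by
  have h1 := h.rank_canonical_sub_le D
  have h2 := h.rank_canonical_sub_le (canonicalDivisor w - D)
  rw [sub_sub_cancel, deg_sub] at h2
  omega

theorem hasRiemannRoch : HasRiemannRoch R (LinearMap.range (lap w)) where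
  orthogonal := by
    rintro _ ⟨f, rfl⟩
    exact h.deg_lap f
  finrank_eq := h.finrank_range_lap
  formula := by
    classical
    let e := Fintype.equivFin V
    let σ : V → ℤ := fun i => (e i : ℕ)
    have hσ : σ.Injective := fun i j hij => e.injective (Fin.ext (Nat.cast_injective hij))
    have hdeg := h.two_mul_deg_orderDivisor hσ
    -- Order divisors maximize the degree on all of `Σ`, so they are extreme and the minimum and
    -- maximum are attained.
    have hmem : deg R (orderDivisor w σ) ∈ deg R '' extremeDivisors R (LinearMap.range (lap w)) := by
      refine ⟨_, ⟨?_, fun p hp _ => ?_⟩, rfl⟩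
      · simpa using h.orderDivisor_add_mem_sigmaRegion σ (Submodule.zero_mem _)
      · have := h.two_mul_deg_le hp
        omega
    have heq : ∀ d ∈ deg R '' extremeDivisors R (LinearMap.range (lap w)),
        d = deg R (orderDivisor w σ) := by
      rintro _ ⟨ν, hν, rfl⟩
      have := h.two_mul_deg_extreme hν
      omega
    refine ⟨deg R (orderDivisor w σ) + 1, ?_, ?_, canonicalDivisor w, by omega, fun D => ?_⟩
    · rw [IsGMin, add_sub_cancel_right]
      exact ⟨hmem, fun d hd => (heq d hd).ge⟩
    · rw [IsGMax, add_sub_cancel_right]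
      exact ⟨hmem, fun d hd => (heq d hd).le⟩
    · have := h.rank_sub_rank_canonical_sub D
      omega

end IsSymmetrizable

end Weighted

/-! ### The associated digraph -/

section Associated

theorem columnLattice_eq_range_lap {V : Type*} [Fintype V] [DecidableEq V] (H : Quiver V)
    [∀ i j, Finite (H.Hom i j)] :
    columnLattice H = LinearMap.range (lap fun i j => (Nat.card (H.Hom i j) : ℤ)) := by
  rw [columnLattice, ← Matrix.range_mulVecLin]
  congr 1
  refine LinearMap.ext fun f => funext fun i => ?_
  rw [Matrix.mulVecLin_apply, laplacian, Matrix.sub_mulVec, Pi.sub_apply, Matrix.mulVec_diagonal,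
    outDegree, Nat.card_sigma, lap_apply]
  simp only [mul_sub, Finset.sum_sub_distrib, Nat.cast_sum, Finset.sum_mul]
  rfl

variable {V E : Type*} {G : Graph V E} [Fintype V(G)] [DecidableEq V(G)] {R : V(G) → ℕ}

theorem IsArithmeticalGraph.finite_hom (h : IsArithmeticalGraph G R) (i j : V(G)) :
    Finite ((associatedDigraph G R).Hom i j) := by
  have : Finite {e : E // G.IsLink e i j} :=
    (h.finite_edges.subset fun e he => he.edge_mem : {e | G.IsLink e i j}.Finite)
  exact inferInstanceAs (Finite (_ × _))

omit [Fintype V(G)] [DecidableEq V(G)] in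
theorem card_associatedDigraph_hom (i j : V(G)) :
    Nat.card ((associatedDigraph G R).Hom i j) = {e | G.IsLink e i j}.ncard * R j := by
  change Nat.card ({e // G.IsLink e i j} × Fin (R j)) = _
  rw [Nat.card_prod, Nat.card_fin]
  rfl

theorem IsArithmeticalGraph.nonempty_hom (h : IsArithmeticalGraph G R) {i j : V(G)}
    (hij : G.toSimpleGraph.Adj i j) : Nonempty ((associatedDigraph G R).Hom i j) := by
  obtain ⟨-, e, he⟩ := hij
  exact ⟨⟨e, he⟩, ⟨0, h.pos j⟩⟩

theorem IsArithmeticalGraph.isStronglyConnected (h : IsArithmeticalGraph G R) :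
    @Quiver.IsStronglyConnected V(G) (associatedDigraph G R) := by
  let _ := associatedDigraph G R
  intro i j
  obtain ⟨p⟩ := h.connected i j
  induction p with
  | nil => exact ⟨Quiver.Path.nil⟩
  | cons hadj _ ih =>
    obtain ⟨a⟩ := h.nonempty_hom hadj
    obtain ⟨b⟩ := ih
    exact ⟨a.toPath.comp b⟩

theorem IsArithmeticalGraph.isSymmetrizable (h : IsArithmeticalGraph G R) :
    IsSymmetrizable R fun i j => (Nat.card ((associatedDigraph G R).Hom i j) : ℤ) where
  pos := h.pos
  nonneg _ _ := by positivity
  diag i := by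
    have : {e | G.IsLink e i i} = ∅ :=
      Set.eq_empty_iff_forall_notMem.2 fun e he => h.loopless.not_isLoopAt e i he
    rw [card_associatedDigraph_hom, this]
    simp
  symm i j := by
    have : {e | G.IsLink e i j} = {e | G.IsLink e j i} := by
      ext e
      exact G.isLink_comm
    rw [card_associatedDigraph_hom, card_associatedDigraph_hom, this]
    push_cast
    ring
  connected := by
    refine h.connected.mono fun i j hij => ?_
    rw [SimpleGraph.fromRel_adj]
    have := h.nonempty_hom hij
    have := h.finite_hom i j
    exact ⟨hij.ne, Or.inl (by exact_mod_cast Nat.card_pos)⟩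

theorem vecMul_laplacian_eq_zero {V : Type*} [Fintype V] [DecidableEq V] {H : Quiver V}
    [∀ i j, Finite (H.Hom i j)] {R : V → ℕ}
    (h : IsSymmetrizable R fun i j => (Nat.card (H.Hom i j) : ℤ)) :
    Matrix.vecMul (fun i => (R i : ℤ)) (laplacian H) = 0 := by
  ext j
  rw [laplacian, Matrix.vecMul_sub, Pi.sub_apply, Matrix.vecMul_diagonal, outDegree,
    Nat.card_sigma, Nat.cast_sum, Finset.mul_sum, Pi.zero_apply, sub_eq_zero]
  -- Symmetry turns the weighted sum of arrows into `j` into `R j` times the out-degree of `j`.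
  exact Finset.sum_congr rfl fun i _ => h.symm j i

end Associated
end ChipFiring

theorem mainTheorem7 {V E : Type*} (G : Graph V E) [Fintype V(G)] [DecidableEq V(G)]
    (R : V(G) → ℕ) (hGR : ChipFiring.IsArithmeticalGraph G R) :
    ChipFiring.HasColumnRiemannRoch (ChipFiring.associatedDigraph G R) R := by
  have hfin := hGR.finite_hom
  exact
    { finite_arrows := hfin
      stronglyConnected := hGR.isStronglyConnected
      currency := ⟨hGR.pos, hGR.gcd_eq_one,
        ChipFiring.vecMul_laplacian_eq_zero hGR.isSymmetrizable⟩
      riemannRoch := by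
        rw [ChipFiring.columnLattice_eq_range_lap]
        exact hGR.isSymmetrizable.hasRiemannRoch }
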